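/- Let $M$ be a compact connected $C^1$-smooth manifold (finite-dimensional, without boundary) with a continuous Riemannian metric, let $|\cdot|_x$ be the Riemannian norm on $T_xM$ and $d$ the geodesic distance. Let $V$ be a vector field on $M$ of class $C^1$ (around every point its components in a chart are $C^1$ functions), and let $\varphi_V:\mathbb R\times M\to M$ be the flow of $\dot x=V(x)$. A point $x_0\in M$ is called minimal if the closure of its orbit $\{\varphi_V(t,x_0):t\in\mathbb R\}$ contains no proper nonempty closed $\varphi_V$-invariant subset. Let $\mathrm{Min}_V$ be the closure of the set of all minimal points, and for $\varepsilon>0$ let $(\mathrm{Min}_V)_\varepsilon=\{x\in M:\exists\, y\in \mathrm{Min}_V,\ d(x,y)<\varepsilon\}$. For $\delta>0$ and $a<b$, a $\delta$-solution of $\dot x=V(x)$ on $[a,b]$ is a continuous, piecewise $C^1$ curve $x:[a,b]\to M$ such that $|\dot x(t)-V(x(t))|_{x(t)}\le\delta$ for every $t\in[a,b]$ at which the derivative $\dot x(t)$ (one-sided at $a$ and $b$) exists. Then for every $\varepsilon>0$ there exist $\delta>0$ and $T>0$ such that every $\delta$-solution $x:[0,T]\to M$ of $\dot x=V(x)$ satisfies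 $$\{x(t):t\in[0,T]\}\cap(\mathrm{Min}_V)_\varepsilon\neq\emptyset .$$ -/

import Mathlib

open Set Filter Topology Manifold Bundle
open scoped ContDiff

section GlobalFlow

variable {E : Type*} [NormedAddCommGroup E] [NormedSpace ℝ E] [CompleteSpace E]
  {H : Type*} [TopologicalSpace H] {I : ModelWithCorners ℝ E H}
  {M : Type*} [TopologicalSpace M] [ChartedSpace H M] [IsManifold I 1 M]
  [BoundarylessManifold I M] {V : (x : M) → TangentSpace I x}

/-- Locally, the integral curves of a `C¹` vector field exist on a uniform time interval. -/
theorem exists_uniform_isMIntegralCurveOn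
    (hV : ContMDiff I I.tangent 1 (fun x ↦ (⟨x, V x⟩ : TangentBundle I M))) (x₀ : M) :
    ∃ U ∈ 𝓝 x₀, ∃ ε > (0 : ℝ), ∀ x ∈ U,
      ∃ γ : ℝ → M, γ 0 = x ∧ IsMIntegralCurveOn γ V (Ioo (-ε) ε) := by
  have hx : I.IsInteriorPoint x₀ := BoundarylessManifold.isInteriorPoint
  have hv := hV.contMDiffAt (x := x₀)
  rw [contMDiffAt_iff] at hv
  obtain ⟨_, hv⟩ := hv
  obtain ⟨ε, hε, a, r, L, K, hr, hpl⟩ := IsPicardLindelof.of_contDiffAt_one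
    (hv.contDiffAt (range_mem_nhds_isInteriorPoint hx)).snd
  obtain ⟨α, hα, hαc⟩ :=
    (hpl 0).exists_forall_mem_closedBall_eq_hasDerivWithinAt_continuousOn
  set y₀ := extChartAt I x₀ x₀ with hy₀
  have hr' : (0 : ℝ) < r := by exact_mod_cast hr
  have hα0 : α (y₀, 0) = y₀ := (hα y₀ (Metric.mem_closedBall_self hr'.le)).1
  have hdom : Metric.closedBall y₀ r ×ˢ Icc ((0 : ℝ) - ε) (0 + ε) ∈ 𝓝 (y₀, (0 : ℝ)) :=
    prod_mem_nhds (Metric.closedBall_mem_nhds _ hr') (Icc_mem_nhds (by linarith) (by linarith))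
  have hcont : ContinuousAt α (y₀, 0) := hαc.continuousAt hdom
  have hW : α ⁻¹' (interior (extChartAt I x₀).target) ∈ 𝓝 (y₀, (0 : ℝ)) := by
    apply hcont.preimage_mem_nhds
    rw [hα0]
    exact isOpen_interior.mem_nhds ((I.isInteriorPoint_iff).mp hx)
  obtain ⟨A, hA, B, hB, hAB⟩ := mem_nhds_prod_iff.mp (inter_mem hdom hW)
  obtain ⟨η, hη, hηB⟩ := Metric.mem_nhds_iff.mp hB
  rw [Real.ball_eq_Ioo, zero_sub, zero_add] at hηB
  refine ⟨(extChartAt I x₀).source ∩ (extChartAt I x₀) ⁻¹' A,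
    inter_mem (extChartAt_source_mem_nhds x₀)
      ((continuousAt_extChartAt x₀).preimage_mem_nhds hA), min η ε, lt_min hη hε, ?_⟩
  rintro x ⟨hxs, hxA⟩
  set y := extChartAt I x₀ x with hy
  have h0B : (0 : ℝ) ∈ B := mem_of_mem_nhds hB
  have hyr : y ∈ Metric.closedBall y₀ r := (hAB (mk_mem_prod hxA h0B)).1.1
  refine ⟨(extChartAt I x₀).symm ∘ (fun t ↦ α (y, t)), ?_, ?_⟩
  · simp only [Function.comp_apply]
    rw [(hα y hyr).1, hy, PartialEquiv.left_inv _ hxs]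
  intro t ht
  have htη : t ∈ Ioo (-η) η :=
    ⟨by linarith [ht.1, min_le_left η ε], by linarith [ht.2, min_le_left η ε]⟩
  have htε : t ∈ Ioo (0 - ε) (0 + ε) :=
    ⟨by linarith [ht.1, min_le_right η ε], by linarith [ht.2, min_le_right η ε]⟩
  have hder := ((hα y hyr).2 t (Ioo_subset_Icc_self htε)).hasDerivAt (Icc_mem_nhds htε.1 htε.2)
  set f : ℝ → E := fun t ↦ α (y, t) with hf
  let xₜ : M := (extChartAt I x₀).symm (f t)
  have h : HasDerivAt f (x := t) <| fderivWithin ℝ (extChartAt I x₀ ∘ (extChartAt I xₜ).symm)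
    (range I) (extChartAt I xₜ xₜ) (V xₜ) := hder
  rw [← tangentCoordChange_def] at h
  have hf3 : f t ∈ interior (extChartAt I x₀).target := (hAB (mk_mem_prod hxA (hηB htη))).2
  have hf3' := mem_of_mem_of_subset hf3 interior_subset
  have hft1 := mem_preimage.mp <|
    mem_of_mem_of_subset hf3' (extChartAt I x₀).target_subset_preimage_source
  have hft2 := mem_extChartAt_source (I := I) xₜ
  have hchart : ∀ w : E, HasDerivAt f (tangentCoordChange I xₜ x₀ xₜ w) t →
      HasDerivAt ((extChartAt I xₜ ∘ (extChartAt I x₀).symm) ∘ f) w t := by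
    intro w hw
    rw [← tangentCoordChange_self (I := I) (x := xₜ) (z := xₜ) (v := w) hft2,
      ← tangentCoordChange_comp (x := x₀) ⟨⟨hft2, hft1⟩, hft2⟩]
    apply HasFDerivAt.comp_hasDerivAt _ _ hw
    apply HasFDerivWithinAt.hasFDerivAt (s := range I) _ <|
      mem_nhds_iff.mpr ⟨interior (extChartAt I x₀).target,
        subset_trans interior_subset (extChartAt_target_subset_range ..),
        isOpen_interior, hf3⟩
    rw [← (extChartAt I x₀).right_inv hf3']
    exact hasFDerivWithinAt_tangentCoordChange ⟨hft1, hft2⟩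
  apply HasMFDerivAt.hasMFDerivWithinAt
  refine ⟨(continuousAt_extChartAt_symm'' hf3').comp h.continuousAt, ?_⟩
  have hF := (hchart _ h).hasFDerivAt.hasFDerivWithinAt (s := range 𝓘(ℝ, ℝ))
  exact hF

/-- On a compact manifold without boundary, a `C¹` vector field is complete. -/
theorem exists_global_isMIntegralCurve [T2Space M] [CompactSpace M]
    (hV : ContMDiff I I.tangent 1 (fun x ↦ (⟨x, V x⟩ : TangentBundle I M))) (x : M) :
    ∃ γ : ℝ → M, γ 0 = x ∧ IsMIntegralCurve γ V := by
  have key : ∃ ε > (0 : ℝ), ∀ x ∈ (univ : Set M),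
      ∃ γ : ℝ → M, γ 0 = x ∧ IsMIntegralCurveOn γ V (Ioo (-ε) ε) := by
    refine isCompact_univ.induction_on (p := fun s : Set M ↦ ∃ ε > (0 : ℝ), ∀ x ∈ s,
      ∃ γ : ℝ → M, γ 0 = x ∧ IsMIntegralCurveOn γ V (Ioo (-ε) ε)) ?_ ?_ ?_ ?_
    · exact ⟨1, one_pos, fun x hx ↦ hx.elim⟩
    · rintro s t hst ⟨ε, hε, h⟩
      exact ⟨ε, hε, fun x hx ↦ h x (hst hx)⟩
    · rintro s t ⟨ε, hε, h⟩ ⟨ε', hε', h'⟩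
      refine ⟨min ε ε', lt_min hε hε', fun x hx ↦ ?_⟩
      rcases hx with hx | hx
      · obtain ⟨γ, h0, hγ⟩ := h x hx
        exact ⟨γ, h0, hγ.mono (Ioo_subset_Ioo (neg_le_neg (min_le_left _ _)) (min_le_left _ _))⟩
      · obtain ⟨γ, h0, hγ⟩ := h' x hx
        exact ⟨γ, h0, hγ.mono (Ioo_subset_Ioo (neg_le_neg (min_le_right _ _)) (min_le_right _ _))⟩
    · intro x _
      obtain ⟨U, hU, ε, hε, h⟩ := exists_uniform_isMIntegralCurveOn hV x
      exact ⟨U, mem_nhdsWithin_of_mem_nhds hU, ε, hε, h⟩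
  obtain ⟨ε, hε, h⟩ := key
  exact exists_isMIntegralCurve_of_isMIntegralCurveOn hV hε (fun x ↦ h x (mem_univ x)) x

/-- The flow `φ_V` of a `C¹` vector field on a compact manifold: `t ↦ flowOf hV t x` is the
(unique) solution of `ẋ = V(x)`, defined for all times, that starts at `x`. -/
noncomputable def flowOf [T2Space M] [CompactSpace M]
    (hV : ContMDiff I I.tangent 1 (fun x ↦ (⟨x, V x⟩ : TangentBundle I M)))
    (t : ℝ) (x : M) : M :=
  Classical.choose (exists_global_isMIntegralCurve hV x) t

theorem flowOf_zero [T2Space M] [CompactSpace M]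
    (hV : ContMDiff I I.tangent 1 (fun x ↦ (⟨x, V x⟩ : TangentBundle I M))) (x : M) :
    flowOf hV 0 x = x :=
  (Classical.choose_spec (exists_global_isMIntegralCurve hV x)).1

theorem isMIntegralCurve_flowOf [T2Space M] [CompactSpace M]
    (hV : ContMDiff I I.tangent 1 (fun x ↦ (⟨x, V x⟩ : TangentBundle I M))) (x : M) :
    IsMIntegralCurve (fun t ↦ flowOf hV t x) V :=
  (Classical.choose_spec (exists_global_isMIntegralCurve hV x)).2

theorem eq_flowOf [T2Space M] [CompactSpace M]
    (hV : ContMDiff I I.tangent 1 (fun x ↦ (⟨x, V x⟩ : TangentBundle I M)))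
    {γ : ℝ → M} (hγ : IsMIntegralCurve γ V) (t : ℝ) : γ t = flowOf hV t (γ 0) :=
  congrFun (isMIntegralCurve_Ioo_eq_of_contMDiff_boundaryless (t₀ := 0) hV hγ
    (isMIntegralCurve_flowOf hV (γ 0)) (flowOf_zero hV (γ 0)).symm) t

end GlobalFlow

section MinimalPoints

variable {X : Type*} [TopologicalSpace X]

/-- The closure of the orbit of `x` under `φ`. -/
def orbitClosure (φ : ℝ → X → X) (x : X) : Set X :=
  closure (range fun t ↦ φ t x)

/-- `x` is minimal for `φ`: the closure of its orbit contains no proper (nonempty) closed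
invariant subset. -/
def IsMinimalPoint (φ : ℝ → X → X) (x : X) : Prop :=
  ∀ A : Set X, A ⊆ orbitClosure φ x → A.Nonempty → IsClosed A → IsInvariant φ A →
    A = orbitClosure φ x

/-- The closure of the set of all minimal points of `φ`. -/
def minimalSet (φ : ℝ → X → X) : Set X :=
  closure {x | IsMinimalPoint φ x}

end MinimalPoints

section DeltaSolutions

variable {E : Type*} [NormedAddCommGroup E] [NormedSpace ℝ E]
  {H : Type*} [TopologicalSpace H] (I : ModelWithCorners ℝ E H)
  {M : Type*} [TopologicalSpace M] [ChartedSpace H M]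

/-- `γ` is continuous on `[a, b]`, and `[a, b]` can be divided into finitely many closed
subintervals on each of which `γ` is of class `C¹`, up to the end points. -/
def IsPiecewiseC1On (γ : ℝ → M) (a b : ℝ) : Prop :=
  ContinuousOn γ (Icc a b) ∧
    ∃ (n : ℕ) (τ : ℕ → ℝ), Monotone τ ∧ τ 0 = a ∧ τ n = b ∧
      ∀ i < n, ContMDiffOn 𝓘(ℝ, ℝ) I 1 γ (Icc (τ i) (τ (i + 1)))

variable {I} [RiemannianBundle (fun x : M ↦ TangentSpace I x)]

/-- `γ : [a, b] → M` is a `δ`-solution of `ẋ = V(x)`: it is piecewise `C¹`, and at every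
`t ∈ [a, b]` where the derivative exists (one-sided at `a` and `b`) it satisfies
`|γ'(t) - V(γ(t))| ≤ δ` in the Riemannian norm. Only the values of `γ` on `[a, b]` matter. -/
def IsDeltaSolution (V : (x : M) → TangentSpace I x) (δ a b : ℝ) (γ : ℝ → M) : Prop :=
  a < b ∧ IsPiecewiseC1On I γ a b ∧
    ∀ t ∈ Icc a b, MDifferentiableWithinAt 𝓘(ℝ, ℝ) I γ (Icc a b) t →
      ‖(mfderivWithin 𝓘(ℝ, ℝ) I γ (Icc a b) t (1 : ℝ) : TangentSpace I (γ t)) - V (γ t)‖ ≤ δ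

end DeltaSolutions

/-! The omega-limit set of any point is nonempty, closed and invariant, so by Zorn it contains a
minimal point. Hence every forward orbit enters the open set `Metric.thickening ε (minimalSet
(flowOf hV))` at some time `s ≥ 0` (`exists_nonneg_mem_of_minimalSet_subset`). For fixed `s`, a
curve that starts near `x` and has small enough error `δ` is near the orbit of `x` at time `s`
(`isShadowed`), so it enters the same open set. Compactness in the starting point makes `δ` and `T`
uniform (`exists_isWeakDeltaSolution_mem`).

Shadowing is a Gronwall estimate in one chart over a short time, chained over a uniform time step.
It is phrased with neighbourhoods, so the geodesic distance is never compared with chart norms; the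
Riemannian norm only measures the error of the derivative. -/

/-! ### Mean value and Gronwall estimates off a countable set. -/

section MeanValue

variable {E : Type*} [NormedAddCommGroup E] [NormedSpace ℝ E] [CompleteSpace E]

/-- Mean value inequality for a continuous function differentiable off a countable set. -/
theorem norm_sub_le_of_norm_deriv_le_off_countable {g : ℝ → E} {a b C : ℝ} (hab : a ≤ b)
    {F : Set ℝ} (hF : F.Countable) (hg : ContinuousOn g (Icc a b))
    (hd : ∀ t ∈ Ioo a b \ F, ∃ D, HasDerivAt g D t ∧ ‖D‖ ≤ C) :
    ‖g b - g a‖ ≤ C * (b - a) := by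
  have hd' : ∀ t ∈ Ioo a b \ F, HasDerivAt g (deriv g t) t ∧ ‖deriv g t‖ ≤ C := by
    intro t ht
    obtain ⟨D, hD, hDC⟩ := hd t ht
    rw [hD.deriv]
    exact ⟨hD, hDC⟩
  have hbound : ∀ᵐ t ∂(MeasureTheory.volume.restrict (Ioc a b)), ‖deriv g t‖ ≤ C := by
    rw [MeasureTheory.ae_restrict_iff' measurableSet_Ioc]
    -- The integral runs over `Ioc a b`, so the end point `b` joins the exceptional set.
    have hnull : MeasureTheory.volume (insert b F) = 0 := (hF.insert b).measure_zero _
    filter_upwards [MeasureTheory.measure_eq_zero_iff_ae_notMem.mp hnull] with t ht htI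
    rw [mem_insert_iff, not_or] at ht
    exact (hd' t ⟨⟨htI.1, lt_of_le_of_ne htI.2 ht.1⟩, ht.2⟩).2
  have hint : IntervalIntegrable (deriv g) MeasureTheory.volume a b := by
    rw [intervalIntegrable_iff_integrableOn_Ioc_of_le hab]
    exact MeasureTheory.Measure.integrableOn_of_bounded measure_Ioc_lt_top.ne
      (aestronglyMeasurable_deriv g _) hbound
  rw [← MeasureTheory.integral_eq_of_hasDerivAt_off_countable_of_le g (deriv g) hab hF hg
    (fun t ht ↦ (hd' t ht).1) hint]
  have h := intervalIntegral.norm_integral_le_of_norm_le_const_ae (a := a) (b := b) (C := C)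
    (f := deriv g) ?_
  · rwa [abs_of_nonneg (sub_nonneg.2 hab)] at h
  · rw [uIoc_of_le hab]
    exact (MeasureTheory.ae_restrict_iff' measurableSet_Ioc).mp hbound

/-- A Gronwall-type estimate on a short interval. -/
theorem norm_le_of_norm_deriv_le_mul_add_off_countable {g : ℝ → E} {a b L K : ℝ} (hab : a ≤ b)
    (hL : 0 ≤ L) (hK : 0 ≤ K) (hLab : L * (b - a) ≤ 1 / 2)
    {F : Set ℝ} (hF : F.Countable) (hg : ContinuousOn g (Icc a b))
    (hd : ∀ t ∈ Ioo a b \ F, ∃ D, HasDerivAt g D t ∧ ‖D‖ ≤ L * ‖g t‖ + K) :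
    ‖g b‖ ≤ 2 * ‖g a‖ + 2 * K * (b - a) := by
  -- At a maximum `c` of `‖g‖` the mean value inequality bounds `‖g c‖` by `‖g a‖ + (L * ‖g c‖ + K)
  -- * (b - a)`, and `hLab` absorbs half of `‖g c‖` into the left side.
  obtain ⟨c, hc, hmax⟩ := isCompact_Icc.exists_isMaxOn (nonempty_Icc.2 hab) hg.norm
  have hmax : ∀ t ∈ Icc a b, ‖g t‖ ≤ ‖g c‖ := hmax
  have hmv : ‖g c - g a‖ ≤ (L * ‖g c‖ + K) * (c - a) := by
    refine norm_sub_le_of_norm_deriv_le_off_countable hc.1 hF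
      (hg.mono (Icc_subset_Icc_right hc.2)) fun t ht ↦ ?_
    have ht' : t ∈ Ioo a b := ⟨ht.1.1, ht.1.2.trans_le hc.2⟩
    obtain ⟨D, hD, hDC⟩ := hd t ⟨ht', ht.2⟩
    exact ⟨D, hD, hDC.trans (by gcongr; exact hmax t (Ioo_subset_Icc_self ht'))⟩
  have h1 : ‖g c‖ ≤ ‖g c - g a‖ + ‖g a‖ := norm_le_norm_sub_add _ _
  have h2 : (L * ‖g c‖ + K) * (c - a) ≤ (L * ‖g c‖ + K) * (b - a) := by
    gcongr
    exact hc.2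
  have h3 : L * (b - a) * ‖g c‖ ≤ 1 / 2 * ‖g c‖ := by gcongr
  have h4 := hmax b ⟨hab, le_rfl⟩
  linarith

end MeanValue

/-! ### Minimal points in omega-limit sets. -/

section MinimalSets

variable {X : Type*} [TopologicalSpace X] {φ : ℝ → X → X}

theorem isInvariant_orbitClosure (hadd : ∀ s t x, φ (s + t) x = φ s (φ t x))
    (hcont : ∀ t, Continuous (φ t)) (x : X) : IsInvariant φ (orbitClosure φ x) := by
  intro t y hy
  refine map_mem_closure (hcont t) hy ?_
  rintro _ ⟨s, rfl⟩
  exact ⟨t + s, hadd t s x⟩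

/-- A nonempty closed invariant subset of a compact space contains a minimal point. -/
theorem exists_isMinimalPoint_mem [CompactSpace X] (hzero : ∀ x, φ 0 x = x)
    (hadd : ∀ s t x, φ (s + t) x = φ s (φ t x)) (hcont : ∀ t, Continuous (φ t))
    {A : Set X} (hA : A.Nonempty) (hAc : IsClosed A) (hAi : IsInvariant φ A) :
    ∃ x ∈ A, IsMinimalPoint φ x := by
  obtain ⟨B, hBA, hB⟩ := zorn_superset_nonempty
    {B : Set X | B.Nonempty ∧ IsClosed B ∧ IsInvariant φ B} (fun c hc hchain hne ↦ by
      have : Nonempty c := hne.to_subtype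
      refine ⟨⋂₀ c, ⟨?_, isClosed_sInter fun B hB ↦ (hc hB).2.1, fun t x hx B hB ↦
        (hc hB).2.2 t (hx B hB)⟩, fun B hB ↦ sInter_subset_of_mem hB⟩
      exact IsCompact.nonempty_sInter_of_directed_nonempty_isCompact_isClosed
        (fun B hB C hC ↦ (hchain.total hB hC).elim
          (fun h ↦ ⟨B, hB, Subset.rfl, h⟩) (fun h ↦ ⟨C, hC, h, Subset.rfl⟩)) (fun B hB ↦ (hc hB).1)
        (fun B hB ↦ (hc hB).2.1.isCompact) (fun B hB ↦ (hc hB).2.1)) A ⟨hA, hAc, hAi⟩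
  have hmin : ∀ C : Set X, C ⊆ B → C.Nonempty → IsClosed C → IsInvariant φ C → C = B :=
    fun C hCB hC hCc hCi ↦ hCB.antisymm (hB.2 ⟨hC, hCc, hCi⟩ hCB)
  obtain ⟨⟨x, hx⟩, hBc, hBi⟩ := hB.1
  have horb : orbitClosure φ x ⊆ B :=
    closure_minimal (by rintro _ ⟨t, rfl⟩; exact hBi t hx) hBc
  refine ⟨x, hBA hx, fun C hC hCn hCc hCi ↦ ?_⟩
  rw [hmin C (hC.trans horb) hCn hCc hCi]
  exact (hmin _ horb ⟨x, subset_closure ⟨0, hzero x⟩⟩ isClosed_closure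
    (isInvariant_orbitClosure hadd hcont x)).symm

/-- Every forward orbit in a compact space enters every neighbourhood of the minimal set. -/
theorem exists_nonneg_mem_of_minimalSet_subset [CompactSpace X] (hzero : ∀ x, φ 0 x = x)
    (hadd : ∀ s t x, φ (s + t) x = φ s (φ t x)) (hcont : ∀ t, Continuous (φ t))
    {U : Set X} (hU : IsOpen U) (hmU : minimalSet φ ⊆ U) (x : X) :
    ∃ t, 0 ≤ t ∧ φ t x ∈ U := by
  have hinv : IsInvariant φ (omegaLimit atTop φ {x}) := by
    intro t y hy
    rw [omegaLimit_def, mem_iInter₂] at hy ⊢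
    intro u hu
    -- The filter `atTop` is stable under translation by any real `t`, negative ones included.
    refine map_mem_closure (hcont t) (hy _ (tendsto_atTop_add_const_left atTop t tendsto_id hu)) ?_
    rintro _ ⟨s, hs, _, rfl, rfl⟩
    exact ⟨t + s, hs, _, rfl, hadd t s _⟩
  obtain ⟨y, hy, hymin⟩ := exists_isMinimalPoint_mem hzero hadd hcont
    (nonempty_omegaLimit atTop φ {x} (singleton_nonempty x)) (isClosed_omegaLimit _ _ _) hinv
  have hfreq := (mem_omegaLimit_iff_frequently _ _ _ _).1 hy U
    (hU.mem_nhds (hmU (subset_closure hymin)))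
  obtain ⟨t, ht, ht0⟩ := (hfreq.and_eventually (eventually_ge_atTop 0)).exists
  obtain ⟨_, rfl, h⟩ := ht
  exact ⟨t, ht0, h⟩

end MinimalSets

/-! ### A class of approximate solutions closed under restriction. -/

section WeakDeltaSolutions

variable {E : Type*} [NormedAddCommGroup E] [NormedSpace ℝ E]
  {H : Type*} [TopologicalSpace H] {I : ModelWithCorners ℝ E H}
  {M : Type*} [TopologicalSpace M] [ChartedSpace H M]
  [RiemannianBundle (fun x : M ↦ TangentSpace I x)]

/-- A continuous curve on `[a, b]` which, off a countable set, is differentiable and satisfies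
`|γ'(t) - V(γ(t))| ≤ δ`. -/
def IsWeakDeltaSolution (V : (x : M) → TangentSpace I x) (δ a b : ℝ) (γ : ℝ → M) : Prop :=
  ContinuousOn γ (Icc a b) ∧ ∃ F : Set ℝ, F.Countable ∧ ∀ t ∈ Ioo a b \ F,
    MDifferentiableAt 𝓘(ℝ, ℝ) I γ t ∧
      ‖(mfderiv 𝓘(ℝ, ℝ) I γ t (1 : ℝ) : TangentSpace I (γ t)) - V (γ t)‖ ≤ δ

variable {V : (x : M) → TangentSpace I x} {δ δ' a b a' b' : ℝ} {γ : ℝ → M}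

theorem IsWeakDeltaSolution.mono (h : IsWeakDeltaSolution V δ a b γ) (ha : a ≤ a') (hb : b' ≤ b)
    (hδ : δ ≤ δ') : IsWeakDeltaSolution V δ' a' b' γ := by
  obtain ⟨hc, F, hF, hd⟩ := h
  refine ⟨hc.mono (Icc_subset_Icc ha hb), F, hF, fun t ht ↦ ?_⟩
  have := hd t ⟨Ioo_subset_Ioo ha hb ht.1, ht.2⟩
  exact ⟨this.1, this.2.trans hδ⟩

/-- Off the countable set of break points, each `t` is interior to a `C¹` piece, so the derivative
exists and is two-sided. -/
theorem IsDeltaSolution.isWeakDeltaSolution (h : IsDeltaSolution V δ a b γ) :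
    IsWeakDeltaSolution V δ a b γ := by
  obtain ⟨-, ⟨hc, n, τ, -, h0, hn, hC1⟩, hd⟩ := h
  refine ⟨hc, range τ, countable_range τ, fun t ht ↦ ?_⟩
  -- If `i + 1` is the first index with `t < τ (i + 1)`, then `t` lies in the open piece from `τ i`
  -- to `τ (i + 1)`.
  have hex : ∃ k, t < τ k := ⟨n, hn ▸ ht.1.2⟩
  classical
  have hk := Nat.find_spec hex
  have hk0 : Nat.find hex ≠ 0 := by
    intro h
    rw [h, h0] at hk
    exact lt_asymm hk ht.1.1
  obtain ⟨i, hi⟩ := Nat.exists_eq_succ_of_ne_zero hk0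
  have hin : i < n := by
    have := Nat.find_min' hex (hn ▸ ht.1.2 : t < τ n)
    omega
  have hti : τ i < t := lt_of_le_of_ne (not_lt.1 (Nat.find_min hex (by omega)))
    fun h ↦ ht.2 ⟨i, h⟩
  rw [hi] at hk
  have hdiff : MDifferentiableAt 𝓘(ℝ, ℝ) I γ t :=
    ((hC1 i hin).contMDiffAt (Icc_mem_nhds hti hk)).mdifferentiableAt one_ne_zero
  refine ⟨hdiff, ?_⟩
  have := hd t (Ioo_subset_Icc_self ht.1) hdiff.mdifferentiableWithinAt
  rwa [mfderivWithin_of_mem_nhds (Icc_mem_nhds ht.1.1 ht.1.2)] at this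

/-- Lets the estimates for approximate solutions apply to flow lines too. -/
theorem IsMIntegralCurve.isWeakDeltaSolution (h : IsMIntegralCurve γ V) (a b : ℝ) :
    IsWeakDeltaSolution V 0 a b γ := by
  refine ⟨h.continuous.continuousOn, ∅, countable_empty, fun t _ ↦
    ⟨(h t).mdifferentiableAt, ?_⟩⟩
  rw [(h t).mfderiv]
  have : ((1 : ℝ →L[ℝ] ℝ).smulRight (V (γ t))) (1 : ℝ) = V (γ t) := by simp
  erw [this]
  simp

end WeakDeltaSolutions

/-! ### Comparing the Riemannian norm with the norm of a chart. -/

section ChartEstimates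

variable {E : Type*} [NormedAddCommGroup E] [NormedSpace ℝ E]
  {H : Type*} [TopologicalSpace H] {I : ModelWithCorners ℝ E H}
  {M : Type*} [TopologicalSpace M] [ChartedSpace H M] [IsManifold I 1 M]
  [RiemannianBundle (fun x : M ↦ TangentSpace I x)]
  [IsContinuousRiemannianBundle E (fun x : M ↦ TangentSpace I x)]

theorem hasDerivAt_of_hasMFDerivAt {g : ℝ → E} {t : ℝ} {L : ℝ →L[ℝ] E}
    (h : HasMFDerivAt 𝓘(ℝ, ℝ) 𝓘(ℝ, E) g t L) : HasDerivAt g (L 1) t := by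
  have h' : HasFDerivAt g L t := hasMFDerivAt_iff_hasFDerivAt.1 h
  exact h'.hasDerivAt

theorem exists_norm_mfderiv_extChartAt_apply_le (x₀ : M) :
    ∃ C > 0, ∀ᶠ p in 𝓝 x₀, ∀ w : TangentSpace I p,
      @norm E _ (mfderiv I 𝓘(ℝ, E) (extChartAt I x₀) p w) ≤ C * ‖w‖ := by
  obtain ⟨C, hC, h⟩ := eventually_norm_mfderiv_extChartAt_lt I x₀
  refine ⟨C, hC, h.mono fun p hp w ↦ ?_⟩
  let := normedAddCommGroupTangentSpaceVectorSpace (E := E)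
  let := normedSpaceTangentSpaceVectorSpace (E := E)
  exact ContinuousLinearMap.le_of_opNorm_le _ hp.le w

/-- In a chart, a `C¹` vector field is given by a Lipschitz bounded map, and being close to
an integral curve in the Riemannian norm implies the same in the norm of the chart. -/
theorem exists_chart_estimates [I.Boundaryless] {V : (x : M) → TangentSpace I x}
    (hV : ContMDiff I I.tangent 1 (fun x ↦ (⟨x, V x⟩ : TangentBundle I M))) (x₀ : M) :
    ∃ r > 0, ∃ L A C : ℝ, 0 < L ∧ 0 < A ∧ 0 < C ∧ ∃ v : E → E,
      Metric.closedBall (extChartAt I x₀ x₀) r ⊆ (extChartAt I x₀).target ∧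
      (∀ u ∈ Metric.closedBall (extChartAt I x₀ x₀) r,
        ∀ w ∈ Metric.closedBall (extChartAt I x₀ x₀) r, ‖v u - v w‖ ≤ L * ‖u - w‖) ∧
      (∀ u ∈ Metric.closedBall (extChartAt I x₀ x₀) r, ‖v u‖ ≤ A) ∧
      ∀ (γ : ℝ → M) (t : ℝ), γ t ∈ (extChartAt I x₀).source →
        extChartAt I x₀ (γ t) ∈ Metric.closedBall (extChartAt I x₀ x₀) r →
        MDifferentiableAt 𝓘(ℝ, ℝ) I γ t →
        ∃ D : E, HasDerivAt (extChartAt I x₀ ∘ γ) D t ∧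
          ‖D - v (extChartAt I x₀ (γ t))‖ ≤
            C * ‖(mfderiv 𝓘(ℝ, ℝ) I γ t (1 : ℝ) : TangentSpace I (γ t)) - V (γ t)‖ := by
  set e := extChartAt I x₀ with he
  -- Two expressions for the field in the chart: `v` fits the chain rule for `e ∘ γ`, while `v'` is
  -- the form in which `hV` gives `C¹` regularity.
  set v : E → E := fun u ↦ mfderiv I 𝓘(ℝ, E) e (e.symm u) (V (e.symm u)) with hv
  set v' : E → E := fun u ↦ tangentCoordChange I (e.symm u) x₀ (e.symm u) (V (e.symm u)) with hv'
  have hvv' : ∀ u ∈ e.target, v u = v' u := by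
    intro u hu
    have hs : e.symm u ∈ (chartAt H x₀).source := by
      rw [← extChartAt_source I]
      exact e.map_target hu
    simp only [hv, hv', he]
    rw [(hasMFDerivAt_extChartAt (I := I) hs).mfderiv, mfderiv_chartAt_eq_tangentCoordChange hs]
    rfl
  have hVx := hV.contMDiffAt (x := x₀)
  rw [contMDiffAt_iff] at hVx
  obtain ⟨_, hVx⟩ := hVx
  have hrange : range I ∈ 𝓝 (e x₀) := by simp [I.range_eq_univ]
  obtain ⟨K, s, hs, hlip⟩ : ∃ K, ∃ s ∈ 𝓝 (e x₀), LipschitzOnWith K v' s :=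
    (hVx.contDiffAt hrange).snd.exists_lipschitzOnWith
  obtain ⟨C, hC, hCe⟩ := exists_norm_mfderiv_extChartAt_apply_le (I := I) x₀
  have htarget : e.target ∈ 𝓝 (e x₀) := extChartAt_target_mem_nhds x₀
  have hCs : {u | ∀ w : TangentSpace I (e.symm u),
      @norm E _ (mfderiv I 𝓘(ℝ, E) e (e.symm u) w) ≤ C * ‖w‖} ∈ 𝓝 (e x₀) := by
    have hc : ContinuousAt e.symm (e x₀) := continuousAt_extChartAt_symm x₀
    have : e.symm (e x₀) = x₀ := e.left_inv (mem_extChartAt_source x₀)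
    unfold ContinuousAt at hc
    rw [this] at hc
    exact hc.eventually hCe
  obtain ⟨r, hr, hball⟩ := Metric.nhds_basis_closedBall.mem_iff.1
    (inter_mem (inter_mem htarget hs) hCs)
  have hlip' : ∀ u ∈ Metric.closedBall (e x₀) r, ∀ w ∈ Metric.closedBall (e x₀) r,
      ‖v u - v w‖ ≤ (K + 1) * ‖u - w‖ := by
    intro u hu w hw
    rw [hvv' u (hball hu).1.1, hvv' w (hball hw).1.1]
    refine (hlip.norm_sub_le (hball hu).1.2 (hball hw).1.2).trans ?_
    gcongr
    linarith
  -- `K + 1` makes the Lipschitz constant strictly positive, as later divisions by it require.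
  refine ⟨r, hr, K + 1, ‖v (e x₀)‖ + (K + 1) * r, C, by positivity, by positivity, hC, v,
    fun u hu ↦ (hball hu).1.1, hlip', fun u hu ↦ ?_, fun γ t hts htb hd ↦ ?_⟩
  · have h1 := hlip' u hu _ (Metric.mem_closedBall_self hr.le)
    have h2 : ‖u - e x₀‖ ≤ r := by simpa [dist_eq_norm] using hu
    have h3 : ‖v u‖ ≤ ‖v u - v (e x₀)‖ + ‖v (e x₀)‖ := norm_le_norm_sub_add _ _
    have h4 : ((K : ℝ) + 1) * ‖u - e x₀‖ ≤ (K + 1) * r := by gcongr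
    linarith
  · have hleft : e.symm (e (γ t)) = γ t := e.left_inv hts
    have hsrc : γ t ∈ (chartAt H x₀).source := by rwa [← extChartAt_source I]
    have hcomp := (hasMFDerivAt_extChartAt (I := I) hsrc).mdifferentiableAt.hasMFDerivAt.comp t
      hd.hasMFDerivAt
    refine ⟨mfderiv I 𝓘(ℝ, E) e (γ t) (mfderiv 𝓘(ℝ, ℝ) I γ t (1 : ℝ)), ?_, ?_⟩
    · exact hasDerivAt_of_hasMFDerivAt hcomp
    · have hb := (hball htb).2
      simp only [mem_ofPred_eq] at hb
      simp only [hv]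
      rw [hleft] at hb ⊢
      have := hb (mfderiv 𝓘(ℝ, ℝ) I γ t (1 : ℝ) - V (γ t))
      rwa [map_sub] at this

end ChartEstimates

/-! ### Shadowing of flow lines, and uniformity by compactness. -/

section Shadowing

variable {E : Type*} [NormedAddCommGroup E] [NormedSpace ℝ E] [ProperSpace E]
  {H : Type*} [TopologicalSpace H] {I : ModelWithCorners ℝ E H}
  {M : Type*} [TopologicalSpace M] [ChartedSpace H M]

/-- A curve of bounded speed in a chart stays for a short time in a ball of the chart. -/
theorem mem_chart_ball_of_norm_deriv_le [T2Space M] {x₀ : M} {γ : ℝ → M} {a b r B : ℝ}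
    (hr : 0 < r) (hB : 0 ≤ B) (hBr : B * (b - a) ≤ r / 4)
    (htarget : Metric.closedBall (extChartAt I x₀ x₀) r ⊆ (extChartAt I x₀).target)
    (hγ : ContinuousOn γ (Icc a b)) {F : Set ℝ} (hF : F.Countable)
    (hd : ∀ t ∈ Ioo a b \ F, γ t ∈ (extChartAt I x₀).source →
      extChartAt I x₀ (γ t) ∈ Metric.closedBall (extChartAt I x₀ x₀) r →
      ∃ D, HasDerivAt (extChartAt I x₀ ∘ γ) D t ∧ ‖D‖ ≤ B)
    (has : γ a ∈ (extChartAt I x₀).source)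
    (hab : extChartAt I x₀ (γ a) ∈ Metric.ball (extChartAt I x₀ x₀) (r / 4)) :
    ∀ t ∈ Icc a b, γ t ∈ (extChartAt I x₀).source ∧
      extChartAt I x₀ (γ t) ∈ Metric.ball (extChartAt I x₀ x₀) r := by
  set e := extChartAt I x₀ with he
  set O : Set M := e.source ∩ e ⁻¹' Metric.ball (e x₀) r with hO
  -- Until it first leaves `O`, the curve travels at most `r / 4` from a start within `r / 4` of the
  -- centre, so it stays in `Q`. As a compact subset of a Hausdorff space `Q` is closed in `M`, so
  -- the exit point would lie in `Q ⊆ O`. The limit is taken in `M` because the chart says nothing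
  -- outside its source.
  set Q : Set M := e.symm '' Metric.closedBall (e x₀) (r / 2) with hQ
  have hOo : IsOpen O := (continuousOn_extChartAt x₀).isOpen_inter_preimage
    (isOpen_extChartAt_source x₀) Metric.isOpen_ball
  have hsub : Metric.closedBall (e x₀) (r / 2) ⊆ Metric.ball (e x₀) r :=
    Metric.closedBall_subset_ball (by linarith)
  have htarget' : Metric.closedBall (e x₀) (r / 2) ⊆ e.target :=
    (hsub.trans Metric.ball_subset_closedBall).trans htarget
  have hQc : IsClosed Q := ((isCompact_closedBall _ _).image_of_continuousOn
    ((continuousOn_extChartAt_symm x₀).mono htarget')).isClosed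
  have hQO : Q ⊆ O := by
    rintro _ ⟨u, hu, rfl⟩
    exact ⟨e.map_target (htarget' hu), by
      rw [mem_preimage, e.right_inv (htarget' hu)]; exact hsub hu⟩
  by_contra! hbad
  obtain ⟨t₁, ht₁, ht₁'⟩ := hbad
  have hclosed : IsClosed (Icc a b ∩ γ ⁻¹' Oᶜ) :=
    hγ.preimage_isClosed_of_isClosed isClosed_Icc hOo.isClosed_compl
  obtain ⟨c, hc, hleast⟩ := (isCompact_Icc.of_isClosed_subset hclosed inter_subset_left).exists_isLeast
    ⟨t₁, ht₁, fun h ↦ ht₁' h.1 h.2⟩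
  have hmem : ∀ t ∈ Ico a c, γ t ∈ O := fun t ht ↦ by
    by_contra h
    exact (hleast ⟨⟨ht.1, ht.2.le.trans hc.1.2⟩, h⟩).not_gt ht.2
  have haO : γ a ∈ O := ⟨has, Metric.ball_subset_ball (by linarith) hab⟩
  have hac : a < c := lt_of_le_of_ne hc.1.1 fun h ↦ hc.2 (h ▸ haO)
  have hmaps : MapsTo γ (Ico a c) Q := by
    intro t ht
    have hspeed : ‖(e ∘ γ) t - (e ∘ γ) a‖ ≤ B * (t - a) := by
      refine norm_sub_le_of_norm_deriv_le_off_countable ht.1 hF ?_ fun t' ht' ↦ ?_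
      · exact (continuousOn_extChartAt x₀).comp
          (hγ.mono (Icc_subset_Icc_right (ht.2.le.trans hc.1.2)))
          fun t' ht' ↦ (hmem t' ⟨ht'.1, ht'.2.trans_lt ht.2⟩).1
      · have h := hmem t' ⟨ht'.1.1.le, ht'.1.2.trans ht.2⟩
        exact hd t' ⟨⟨ht'.1.1, ht'.1.2.trans (ht.2.trans_le hc.1.2)⟩, ht'.2⟩ h.1
          (Metric.ball_subset_closedBall h.2)
    have h1 : B * (t - a) ≤ B * (b - a) := by
      gcongr
      exact ht.2.le.trans hc.1.2
    refine ⟨e (γ t), ?_, e.left_inv (hmem t ht).1⟩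
    rw [Metric.mem_closedBall]
    rw [Metric.mem_ball] at hab
    have h2 := dist_triangle (e (γ t)) (e (γ a)) (e x₀)
    rw [dist_eq_norm (e (γ t)) (e (γ a))] at h2
    simp only [Function.comp_apply] at hspeed
    linarith
  have hcQ : γ c ∈ closure Q := by
    refine ContinuousWithinAt.mem_closure (s := Ico a c) ?_ ?_ hmaps
    · exact (hγ c hc.1).mono fun t ht ↦ ⟨ht.1, ht.2.le.trans hc.1.2⟩
    · rw [closure_Ico hac.ne]
      exact ⟨hac.le, le_rfl⟩
  rw [hQc.closure_eq] at hcQ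
  exact hc.2 (hQO hcQ)

variable [IsManifold I 1 M] [BoundarylessManifold I M] [T2Space M] [CompactSpace M]
  {V : (x : M) → TangentSpace I x}

theorem flowOf_add (hV : ContMDiff I I.tangent 1 (fun x ↦ (⟨x, V x⟩ : TangentBundle I M)))
    (s t : ℝ) (x : M) : flowOf hV (s + t) x = flowOf hV s (flowOf hV t x) := by
  have h := eq_flowOf hV ((isMIntegralCurve_flowOf hV x).comp_add t) s
  simpa using h

variable [RiemannianBundle (fun x : M ↦ TangentSpace I x)]

/-- Approximate solutions that start near `y` are near `φ(s, y)` after time `s`. -/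
def IsShadowed (hV : ContMDiff I I.tangent 1 (fun x ↦ (⟨x, V x⟩ : TangentBundle I M)))
    (s : ℝ) (y : M) : Prop :=
  ∀ U ∈ 𝓝 (flowOf hV s y), ∃ N ∈ 𝓝 y, ∃ δ > (0 : ℝ), ∀ (a b : ℝ) (γ : ℝ → M),
    IsWeakDeltaSolution V δ a b γ → γ a ∈ N → a + s ≤ b → γ (a + s) ∈ U

/-- The starting neighbourhood of the second stretch serves as the target of the first; the curve is
then restarted at `a + s`. -/
theorem IsShadowed.add {hV : ContMDiff I I.tangent 1 (fun x ↦ (⟨x, V x⟩ : TangentBundle I M))}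
    {s t : ℝ} {y : M} (hs : 0 ≤ s) (ht : 0 ≤ t) (h : IsShadowed hV s y)
    (h' : IsShadowed hV t (flowOf hV s y)) : IsShadowed hV (s + t) y := by
  intro U hU
  rw [add_comm, flowOf_add] at hU
  obtain ⟨N, hN, δ, hδ, hNδ⟩ := h' U hU
  obtain ⟨N', hN', δ', hδ', hNδ'⟩ := h N hN
  refine ⟨N', hN', min δ δ', lt_min hδ hδ', fun a b γ hγ ha hb ↦ ?_⟩
  rw [← add_assoc]
  exact hNδ (a + s) b γ (hγ.mono (by linarith) le_rfl (min_le_left _ _))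
    (hNδ' a b γ (hγ.mono le_rfl le_rfl (min_le_right _ _)) ha (by linarith)) (by linarith)

variable [I.Boundaryless] [IsContinuousRiemannianBundle E (fun x : M ↦ TangentSpace I x)]

/-- In a chart, the difference `g` of the curve and the flow line satisfies `‖g'‖ ≤ L * ‖g‖ + C *
δ`, so the short-time Gronwall bound applies. -/
theorem exists_isShadowed_nhds
    (hV : ContMDiff I I.tangent 1 (fun x ↦ (⟨x, V x⟩ : TangentBundle I M))) (x₀ : M) :
    ∃ W ∈ 𝓝 x₀, ∃ τ > (0 : ℝ), ∀ z ∈ W, ∀ s ∈ Icc 0 τ, IsShadowed hV s z := by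
  obtain ⟨r, hr, L, A, C, hL, hA, hC, v, htarget, hlip, hbound, hchart⟩ :=
    exists_chart_estimates hV x₀
  set e := extChartAt I x₀ with he
  have hWo : IsOpen (e.source ∩ e ⁻¹' Metric.ball (e x₀) (r / 4)) :=
    (continuousOn_extChartAt x₀).isOpen_inter_preimage
      (isOpen_extChartAt_source x₀) Metric.isOpen_ball
  have hstay : ∀ (a b δ : ℝ) (γ : ℝ → M), δ ≤ 1 → (A + C) * (b - a) ≤ r / 4 →
      IsWeakDeltaSolution V δ a b γ → γ a ∈ e.source ∩ e ⁻¹' Metric.ball (e x₀) (r / 4) →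
      ∀ t ∈ Icc a b, γ t ∈ e.source ∧ e (γ t) ∈ Metric.ball (e x₀) r := by
    rintro a b δ γ hδ hab ⟨hγ, F, hF, hd⟩ ha
    refine mem_chart_ball_of_norm_deriv_le hr (by positivity) hab htarget hγ hF
      (fun t ht hts htb ↦ ?_) ha.1 ha.2
    obtain ⟨D, hD, hDC⟩ := hchart γ t hts htb (hd t ht).1
    refine ⟨D, hD, ?_⟩
    have h1 := hbound _ htb
    have h2 : ‖D‖ ≤ ‖D - v (e (γ t))‖ + ‖v (e (γ t))‖ := norm_le_norm_sub_add _ _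
    have h3 := mul_le_mul_of_nonneg_left ((hd t ht).2.trans hδ) hC.le
    linarith
  -- The first bound on time confines curves of speed at most `A + C` to the chart ball; the second
  -- gives `L * s ≤ 1 / 2` for Gronwall.
  refine ⟨_, hWo.mem_nhds ⟨mem_extChartAt_source x₀, Metric.mem_ball_self (by positivity)⟩,
    min (r / (4 * (A + C))) (1 / (2 * L)), lt_min (by positivity) (by positivity), ?_⟩
  rintro z hz s ⟨hs, hsτ⟩ U hU
  have hsr : (A + C) * s ≤ r / 4 := by
    have := mul_le_mul_of_nonneg_left (hsτ.trans (min_le_left _ _)) (add_pos hA hC).le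
    have h : (A + C) * (r / (4 * (A + C))) = r / 4 := by field_simp
    linarith
  have hsL : L * s ≤ 1 / 2 := by
    have := mul_le_mul_of_nonneg_left (hsτ.trans (min_le_right _ _)) hL.le
    have h : L * (1 / (2 * L)) = 1 / 2 := by field_simp
    linarith
  have hflow : ∀ a : ℝ, IsMIntegralCurve (fun t ↦ flowOf hV (t - a) z) V := fun a ↦
    (isMIntegralCurve_flowOf hV z).comp_add (-a)
  have hflowstay : ∀ a : ℝ, ∀ t ∈ Icc a (a + s), flowOf hV (t - a) z ∈ e.source ∧
      e (flowOf hV (t - a) z) ∈ Metric.ball (e x₀) r := fun a ↦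
    hstay a (a + s) 0 (fun t ↦ flowOf hV (t - a) z) zero_le_one (by simpa using hsr)
      ((hflow a).isWeakDeltaSolution _ _) (by simpa [flowOf_zero] using hz)
  have hend : flowOf hV s z ∈ e.source := by
    simpa using (hflowstay 0 s (by simp [hs])).1
  have hUe : e.symm ⁻¹' U ∈ 𝓝 (e (flowOf hV s z)) := by
    have hc : ContinuousAt e.symm (e (flowOf hV s z)) := continuousAt_extChartAt_symm' hend
    refine hc.preimage_mem_nhds ?_
    rwa [e.left_inv hend]
  obtain ⟨ρ, hρ, hρU⟩ := Metric.mem_nhds_iff.1 hUe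
  have hNe : e ⁻¹' Metric.ball (e z) (ρ / 4) ∈ 𝓝 z :=
    (continuousAt_extChartAt' hz.1).preimage_mem_nhds (Metric.ball_mem_nhds _ (by positivity))
  -- The initial gap `ρ / 4` and the error `δ` each contribute at most `ρ / 2` to the final gap; `s
  -- + 1` keeps the denominator positive at `s = 0`.
  refine ⟨_, inter_mem (hWo.mem_nhds hz) hNe, min 1 (ρ / (4 * C * (s + 1))),
    lt_min one_pos (by positivity), fun a b γ hγ ha hb ↦ ?_⟩
  set δ := min 1 (ρ / (4 * C * (s + 1))) with hδ
  have hδ0 : 0 ≤ δ := le_min zero_le_one (by positivity)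
  replace hγ : IsWeakDeltaSolution V δ a (a + s) γ := hγ.mono le_rfl hb le_rfl
  have hγstay := hstay a (a + s) δ γ (min_le_left _ _) (by simpa using hsr) hγ ha.1
  obtain ⟨hγc, F, hF, hFd⟩ := hγ
  obtain ⟨hfc, F', hF', hFd'⟩ := (hflow a).isWeakDeltaSolution a (a + s)
  have hest := norm_le_of_norm_deriv_le_mul_add_off_countable (E := E)
    (g := fun t ↦ (e ∘ γ) t - (e ∘ fun t ↦ flowOf hV (t - a) z) t) (a := a) (b := a + s) (L := L)
    (K := C * δ) (by linarith) hL.le (by positivity) (by simpa using hsL) (hF.union hF')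
    (((continuousOn_extChartAt x₀).comp hγc fun t ht ↦ (hγstay t ht).1).sub
      ((continuousOn_extChartAt x₀).comp hfc fun t ht ↦ (hflowstay a t ht).1))
    (fun t ht ↦ by
      have htI := Ioo_subset_Icc_self ht.1
      have hb1 := Metric.ball_subset_closedBall (hγstay t htI).2
      have hb2 := Metric.ball_subset_closedBall (hflowstay a t htI).2
      have hd1 := hFd t ⟨ht.1, fun h ↦ ht.2 (Or.inl h)⟩
      have hd2 := hFd' t ⟨ht.1, fun h ↦ ht.2 (Or.inr h)⟩
      obtain ⟨D, hD, hDC⟩ := hchart γ t (hγstay t htI).1 hb1 hd1.1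
      obtain ⟨D', hD', hDC'⟩ := hchart (fun t ↦ flowOf hV (t - a) z) t (hflowstay a t htI).1 hb2
        hd2.1
      refine ⟨D - D', hD.sub hD', ?_⟩
      have h1 := hlip _ hb1 _ hb2
      have h2 := mul_le_mul_of_nonneg_left hd1.2 hC.le
      have h3 := mul_le_mul_of_nonneg_left hd2.2 hC.le
      have h4 : D - D' = (D - v (e (γ t))) + (v (e (γ t)) - v (e (flowOf hV (t - a) z)))
        - (D' - v (e (flowOf hV (t - a) z))) := by abel
      rw [h4]
      have h5 := norm_sub_le ((D - v (e (γ t))) + (v (e (γ t)) - v (e (flowOf hV (t - a) z))))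
        (D' - v (e (flowOf hV (t - a) z)))
      have h6 := norm_add_le (D - v (e (γ t))) (v (e (γ t)) - v (e (flowOf hV (t - a) z)))
      simp only [Function.comp_apply]
      linarith)
  simp only [Function.comp_apply, add_sub_cancel_left, sub_self, flowOf_zero] at hest
  have h1 : ‖e (γ a) - e z‖ < ρ / 4 := by simpa [dist_eq_norm] using ha.2
  have h2 : 2 * (C * δ) * s ≤ ρ / 2 := by
    have h : δ ≤ ρ / (4 * C * (s + 1)) := min_le_right _ _
    rw [le_div_iff₀ (by positivity)] at h
    have : 0 ≤ C * δ := by positivity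
    linarith
  have h3 : e (γ (a + s)) ∈ Metric.ball (e (flowOf hV s z)) ρ := by
    rw [Metric.mem_ball, dist_eq_norm]
    linarith
  have h4 := hρU h3
  rwa [mem_preimage, e.left_inv (hγstay (a + s) ⟨by linarith, le_rfl⟩).1] at h4

/-- Compactness gives one step length `τ` valid at every point; a time `s ≤ n * τ` is then reached
by induction on `n`, splitting off one step at the start. -/
theorem isShadowed (hV : ContMDiff I I.tangent 1 (fun x ↦ (⟨x, V x⟩ : TangentBundle I M)))
    {s : ℝ} (hs : 0 ≤ s) (y : M) : IsShadowed hV s y := by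
  obtain ⟨τ, hτ, h⟩ : ∃ τ > (0 : ℝ), ∀ z ∈ (univ : Set M), ∀ s ∈ Icc 0 τ, IsShadowed hV s z := by
    refine isCompact_univ.induction_on
      (p := fun S ↦ ∃ τ > (0 : ℝ), ∀ z ∈ S, ∀ s ∈ Icc 0 τ, IsShadowed hV s z)
      ⟨1, one_pos, fun z hz ↦ hz.elim⟩ ?_ ?_ ?_
    · rintro S S' hSS' ⟨τ, hτ, h⟩
      exact ⟨τ, hτ, fun z hz ↦ h z (hSS' hz)⟩
    · rintro S S' ⟨τ, hτ, h⟩ ⟨τ', hτ', h'⟩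
      refine ⟨min τ τ', lt_min hτ hτ', fun z hz s hs ↦ hz.elim (fun hz ↦ h z hz s ?_)
        (fun hz ↦ h' z hz s ?_)⟩
      · exact ⟨hs.1, hs.2.trans (min_le_left _ _)⟩
      · exact ⟨hs.1, hs.2.trans (min_le_right _ _)⟩
    · intro x _
      obtain ⟨W, hW, h⟩ := exists_isShadowed_nhds hV x
      exact ⟨W, mem_nhdsWithin_of_mem_nhds hW, h⟩
  have key : ∀ n : ℕ, ∀ s, 0 ≤ s → s ≤ n * τ → ∀ y, IsShadowed hV s y := by
    intro n
    induction n with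
    | zero =>
      intro s hs hsn y
      exact h y (mem_univ y) s ⟨hs, by simp at hsn; linarith⟩
    | succ n ih =>
      intro s hs hsn y
      rcases le_total s τ with hsτ | hsτ
      · exact h y (mem_univ y) s ⟨hs, hsτ⟩
      · rw [← add_sub_cancel τ s]
        refine (h y (mem_univ y) τ ⟨hτ.le, le_rfl⟩).add hτ.le (sub_nonneg.2 hsτ)
          (ih _ (sub_nonneg.2 hsτ) ?_ _)
        push_cast at hsn
        linarith
  obtain ⟨n, hn⟩ := exists_nat_ge (s / τ)
  exact key n s hs ((div_le_iff₀ hτ).1 hn) y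

/-- Nearby flow lines are themselves approximate solutions, so shadowing yields continuity for `t ≥
0`. For `t ≤ 0` the map is the inverse of a continuous bijection of a compact Hausdorff space. -/
theorem continuous_flowOf (hV : ContMDiff I I.tangent 1 (fun x ↦ (⟨x, V x⟩ : TangentBundle I M)))
    (t : ℝ) : Continuous (flowOf hV t) := by
  have hpos : ∀ s : ℝ, 0 ≤ s → Continuous (flowOf hV s) := by
    refine fun s hs ↦ continuous_iff_continuousAt.2 fun y U hU ↦ ?_
    obtain ⟨N, hN, δ, hδ, h⟩ := isShadowed hV hs y U hU
    rw [mem_map]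
    refine mem_of_superset hN fun x hx ↦ ?_
    have := h 0 s (fun t ↦ flowOf hV t x) (((isMIntegralCurve_flowOf hV x).isWeakDeltaSolution
      0 s).mono le_rfl le_rfl hδ.le) (by simpa [flowOf_zero] using hx) (by simp)
    simpa using this
  rcases le_total 0 t with ht | ht
  · exact hpos t ht
  · let Φ : M ≃ M :=
      { toFun := flowOf hV (-t)
        invFun := flowOf hV t
        left_inv := fun x ↦ by rw [← flowOf_add, add_neg_cancel, flowOf_zero]
        right_inv := fun x ↦ by rw [← flowOf_add, neg_add_cancel, flowOf_zero] }
    exact (Continuous.homeoOfEquivCompactToT2 (f := Φ) (hpos (-t) (by linarith))).symm.continuous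

/-- Approximate solutions enter a given neighbourhood of the minimal set in bounded time. -/
theorem exists_isWeakDeltaSolution_mem
    (hV : ContMDiff I I.tangent 1 (fun x ↦ (⟨x, V x⟩ : TangentBundle I M)))
    {U : Set M} (hU : IsOpen U) (hmU : minimalSet (flowOf hV) ⊆ U) :
    ∃ δ : ℝ, 0 < δ ∧ ∃ T : ℝ, 0 < T ∧ ∀ γ : ℝ → M, IsWeakDeltaSolution V δ 0 T γ →
      ∃ t ∈ Icc 0 T, γ t ∈ U := by
  have key : ∃ δ : ℝ, 0 < δ ∧ ∃ T : ℝ, 0 < T ∧ ∀ γ : ℝ → M, IsWeakDeltaSolution V δ 0 T γ →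
      γ 0 ∈ (univ : Set M) → ∃ t ∈ Icc 0 T, γ t ∈ U := by
    refine isCompact_univ.induction_on
      (p := fun S ↦ ∃ δ : ℝ, 0 < δ ∧ ∃ T : ℝ, 0 < T ∧ ∀ γ : ℝ → M,
        IsWeakDeltaSolution V δ 0 T γ → γ 0 ∈ S → ∃ t ∈ Icc 0 T, γ t ∈ U)
      ⟨1, one_pos, 1, one_pos, fun γ _ h ↦ h.elim⟩ ?_ ?_ ?_
    · rintro S S' hSS' ⟨δ, hδ, T, hT, h⟩
      exact ⟨δ, hδ, T, hT, fun γ hγ h0 ↦ h γ hγ (hSS' h0)⟩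
    · rintro S S' ⟨δ, hδ, T, hT, h⟩ ⟨δ', hδ', T', hT', h'⟩
      refine ⟨min δ δ', lt_min hδ hδ', max T T', lt_max_of_lt_left hT, fun γ hγ h0 ↦ ?_⟩
      rcases h0 with h0 | h0
      · obtain ⟨t, ht, htU⟩ := h γ (hγ.mono le_rfl (le_max_left _ _) (min_le_left _ _)) h0
        exact ⟨t, ⟨ht.1, ht.2.trans (le_max_left _ _)⟩, htU⟩
      · obtain ⟨t, ht, htU⟩ := h' γ (hγ.mono le_rfl (le_max_right _ _) (min_le_right _ _)) h0
        exact ⟨t, ⟨ht.1, ht.2.trans (le_max_right _ _)⟩, htU⟩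
    · intro x _
      obtain ⟨s, hs, hsU⟩ := exists_nonneg_mem_of_minimalSet_subset (flowOf_zero hV)
        (flowOf_add hV) (continuous_flowOf hV) hU hmU x
      obtain ⟨N, hN, δ, hδ, h⟩ := isShadowed hV hs x U (hU.mem_nhds hsU)
      -- `s` may be `0`, and `T` must be positive.
      refine ⟨N, mem_nhdsWithin_of_mem_nhds hN, δ, hδ, s + 1, by linarith, fun γ hγ h0 ↦
        ⟨s, ⟨hs, by linarith⟩, ?_⟩⟩
      simpa using h 0 (s + 1) γ hγ h0 (by linarith)
  obtain ⟨δ, hδ, T, hT, h⟩ := key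
  exact ⟨δ, hδ, T, hT, fun γ hγ ↦ h γ hγ (mem_univ _)⟩

end Shadowing

theorem mainTheorem8 {d : ℕ}
    {M : Type*} [EMetricSpace M] [ChartedSpace (EuclideanSpace ℝ (Fin d)) M]
    [IsManifold (𝓡 d) 1 M] [CompactSpace M] [ConnectedSpace M]
    [RiemannianBundle (fun x : M ↦ TangentSpace (𝓡 d) x)]
    [IsContinuousRiemannianBundle (EuclideanSpace ℝ (Fin d))
      (fun x : M ↦ TangentSpace (𝓡 d) x)]
    [IsRiemannianManifold (𝓡 d) M]
    (V : (x : M) → TangentSpace (𝓡 d) x)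
    (hV : ContMDiff (𝓡 d) (𝓡 d).tangent 1
      (fun x ↦ (⟨x, V x⟩ : TangentBundle (𝓡 d) M))) :
    ∀ ε : ℝ, 0 < ε → ∃ δ : ℝ, 0 < δ ∧ ∃ T : ℝ, 0 < T ∧
      ∀ x : ℝ → M, IsDeltaSolution V δ 0 T x →
        (x '' Icc 0 T ∩ Metric.thickening ε (minimalSet (flowOf hV))).Nonempty := by
  intro ε hε
  obtain ⟨δ, hδ, T, hT, h⟩ := exists_isWeakDeltaSolution_mem hV
    (Metric.isOpen_thickening (δ := ε)) (Metric.self_subset_thickening hε _)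
  refine ⟨δ, hδ, T, hT, fun x hx ↦ ?_⟩
  obtain ⟨t, ht, htU⟩ := h x hx.isWeakDeltaSolution
  exact ⟨x t, mem_image_of_mem x ht, htU⟩
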